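/- Let $\Bbbk$ be an algebraically closed field of characteristic zero, let $r \geqslant 2$ and $n \geqslant r+1$ be integers, and put $k = n-r-1$, $[n]=\{1,\dots,n\}$. For a finite set $I$ with $|I| \geqslant r+1$ let $X(r,I) = U(r,I)/\mathrm{PGL}_r$ be the moduli space of linearly general configurations of points in $\mathbb{P}^{r-1}_{\Bbbk}$ labelled by $I$ (every set of at most $r$ of the points is linearly independent), up to the diagonal action of $\mathrm{PGL}_r$. It is an irreducible affine variety of dimension $(r-1)(|I|-r-1)$; its regular functions are those whose pullbacks to $U(r,I) \subseteq (\mathbb{P}^{r-1})^I$ are regular. Let $I_1,\dots,I_k \subseteq [n]$ be subsets of size $r+2$ and $\mathcal{I} = (I_1,\dots,I_k)$. Let $$\operatorname{fgt}_{\mathcal{I}} \colon X(r,[n]) \to \prod_{j=1}^{k} X(r,I_j)$$ be the morphism whose $j$th component forgets the points with labels outside $I_j$; it is a morphism between irreducible varieties of the same dimension. Let $d_{r,n}(\mathcal{I}) \in \mathbb{N}$ be its degree, that is, the degree of the induced extension of function fields if $\operatorname{fgt}_{\mathcal{I}}$ is dominant, and $0$ otherwise. If $d_{r,n}(\mathcal{I})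 \neq 0$, then $\mathcal{I}$ satisfies the surplus condition: for every nonempty subset $J \subseteq \{1,\dots,k\}$, $$\Bigl| \bigcup_{j \in J} I_j \Bigr| \geqslant |J| + r + 1.$$ -/

import Mathlib

open scoped LinearAlgebra.Projectivization MatrixGroups

noncomputable section

namespace ProjConfig

/-! ### Affine varieties as point sets with an algebra of regular functions

Over an algebraically closed field, an affine variety is given by its set `X` of closed points
together with its coordinate ring, a subalgebra `A` of the algebra of all functions `X → K`. -/

section Degree

variable {K : Type*} [Field K] {X Y : Type*}

/-- `f : X → Y` is a morphism: it pulls regular functions back to regular functions. -/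
def IsMorphism (A : Subalgebra K (X → K)) (B : Subalgebra K (Y → K)) (f : X → Y) : Prop :=
  ∀ g ∈ B, g ∘ f ∈ A

/-- The Zariski topology on `Y`: its closed sets are the common zero loci of sets of regular
functions. -/
abbrev zariskiTopology (B : Subalgebra K (Y → K)) : TopologicalSpace Y :=
  TopologicalSpace.generateFrom {U | ∃ g ∈ B, U = {y | g y ≠ 0}}

/-- `f` is dominant: its image is dense in the Zariski topology of `Y`. -/
def IsDominant (B : Subalgebra K (Y → K)) (f : X → Y) : Prop :=
  @Dense Y (zariskiTopology B) (Set.range f)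

/-- The comorphism `g ↦ g ∘ f`. -/
def comorphism {A : Subalgebra K (X → K)} {B : Subalgebra K (Y → K)} {f : X → Y}
    (hf : IsMorphism A B f) : B →ₐ[K] A where
  toFun g := ⟨(g : Y → K) ∘ f, hf g g.2⟩
  map_one' := rfl
  map_mul' _ _ := rfl
  map_zero' := rfl
  map_add' _ _ := rfl
  commutes' _ := rfl

theorem comorphism_injective {A : Subalgebra K (X → K)} {B : Subalgebra K (Y → K)} {f : X → Y}
    (hf : IsMorphism A B f) (hd : IsDominant B f) : Function.Injective (comorphism hf) := by
  rw [injective_iff_map_eq_zero]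
  intro g hg
  have hg' : ∀ x, (g : Y → K) (f x) = 0 := fun x =>
    congrFun (congrArg Subtype.val hg) x
  ext y
  by_contra hy
  let _ := zariskiTopology B
  have hU : IsOpen {y | (g : Y → K) y ≠ 0} :=
    TopologicalSpace.isOpen_generateFrom_of_mem ⟨g, g.2, rfl⟩
  obtain ⟨_, hz, x, rfl⟩ := Dense.inter_open_nonempty hd _ hU ⟨y, hy⟩
  exact hz (hg' x)

/-- The degree of the extension of fraction fields induced by an injective ring homomorphism into
a domain. -/
def fractionDegree {R S : Type*} [CommRing R] [CommRing S] [IsDomain S] (φ : R →+* S)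
    (hφ : Function.Injective φ) : ℕ :=
  letI : Algebra (FractionRing R) (FractionRing S) :=
    (IsFractionRing.map hφ : FractionRing R →+* FractionRing S).toAlgebra
  Module.finrank (FractionRing R) (FractionRing S)

open Classical in
/-- The degree of a morphism `f : X → Y` between irreducible affine varieties of the same dimension:
the degree `[K(X) : K(Y)]` of the extension of function fields if `f` is dominant, and `0`
otherwise. -/
def degree (A : Subalgebra K (X → K)) [IsDomain A] (B : Subalgebra K (Y → K)) (f : X → Y)
    (hf : IsMorphism A B f) : ℕ :=
  if hd : IsDominant B f then
    fractionDegree (comorphism hf).toRingHom (comorphism_injective hf hd)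
  else 0

/-- The coordinate ring of a product of affine varieties: it is generated by the pullbacks of the
regular functions on the factors. -/
def productRegular {J : Type*} {Z : J → Type*} (B : ∀ j, Subalgebra K (Z j → K)) :
    Subalgebra K ((∀ j, Z j) → K) :=
  Algebra.adjoin K {h | ∃ j, ∃ g ∈ B j, h = fun z => g (z j)}

end Degree

/-! ### Projective configuration spaces -/

section Space

variable (K : Type*) [Field K] (r : ℕ)

/-- A configuration of points of `ℙ^{r-1}` is linearly general if any `r` or fewer of the points
are linearly independent; that is, no `l`-dimensional linear subspace with `l ≤ r - 2` contains
`l + 2` of the points. -/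
def IsLinearlyGeneral {ι : Type*} (p : ι → ℙ K (Fin r → K)) : Prop :=
  ∀ s : Finset ι, s.card ≤ r → Projectivization.Independent (fun i : s => p i)

/-- `U(r, ι)`: linearly general configurations of points of `ℙ^{r-1}` labelled by `ι`. -/
def GeneralConfig (ι : Type*) : Type _ :=
  {p : ι → ℙ K (Fin r → K) // IsLinearlyGeneral K r p}

/-- Two configurations are equivalent if they lie in the same orbit of the diagonal action of
`PGL_r`. -/
def configSetoid (ι : Type*) : Setoid (GeneralConfig K r ι) :=
  (MulAction.orbitRel PGL(Fin r, K) (ι → ℙ K (Fin r → K))).comap Subtype.val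

/-- `X(r, ι) = U(r, ι) / PGL_r`. -/
def ConfigSpace (ι : Type*) : Type _ :=
  Quotient (configSetoid K r ι)

variable {K r}

/-- The class in `X(r, ι)` of a linearly general configuration. -/
def ConfigSpace.mk {ι : Type*} (p : GeneralConfig K r ι) : ConfigSpace K r ι :=
  Quotient.mk (configSetoid K r ι) p

/-- The value of a polynomial in the homogeneous coordinates of the points `[v i]`; the variable
`(i, a)` is the `a`-th coordinate of the `i`-th point. -/
def evalAt {ι : Type*} (v : ι → Fin r → K) (P : MvPolynomial (ι × Fin r) K) : K :=
  MvPolynomial.eval (fun x : ι × Fin r => v x.1 x.2) P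

/-- `f : X(r, ι) → K` is regular if its pullback to the open set of linearly general configurations
is regular: in the homogeneous coordinates of the points it is a quotient `P / Q` of polynomials
with `Q` nowhere zero on linearly general configurations (a single such quotient suffices, since the
polynomial ring is a unique factorization domain). As `X(r, ι)` is affine when `ι` has at least
`r + 1` elements, these functions form its coordinate ring. -/
def IsRegular {ι : Type*} (f : ConfigSpace K r ι → K) : Prop :=
  ∃ P Q : MvPolynomial (ι × Fin r) K,
    ∀ (p : GeneralConfig K r ι) (v : ι → Fin r → K) (hv : ∀ i, v i ≠ 0),
      (∀ i, Projectivization.mk K (v i) (hv i) = p.1 i) →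
        evalAt v Q ≠ 0 ∧ f (ConfigSpace.mk p) = evalAt v P / evalAt v Q

variable (K r)

/-- The coordinate ring of `X(r, ι)`. -/
def regularFunctions (ι : Type*) : Subalgebra K (ConfigSpace K r ι → K) where
  carrier := {f | IsRegular f}
  mul_mem' := by
    rintro f g ⟨P, Q, h⟩ ⟨P', Q', h'⟩
    refine ⟨P * P', Q * Q', fun p v hv e => ?_⟩
    obtain ⟨h1, h2⟩ := h p v hv e
    obtain ⟨h1', h2'⟩ := h' p v hv e
    simp only [evalAt, map_mul, Pi.mul_apply] at *
    exact ⟨mul_ne_zero h1 h1', by rw [h2, h2', div_mul_div_comm]⟩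
  add_mem' := by
    rintro f g ⟨P, Q, h⟩ ⟨P', Q', h'⟩
    refine ⟨P * Q' + Q * P', Q * Q', fun p v hv e => ?_⟩
    obtain ⟨h1, h2⟩ := h p v hv e
    obtain ⟨h1', h2'⟩ := h' p v hv e
    simp only [evalAt, map_mul, map_add, Pi.add_apply] at *
    exact ⟨mul_ne_zero h1 h1', by rw [h2, h2', div_add_div _ _ h1 h1']⟩
  algebraMap_mem' c := ⟨MvPolynomial.C c, 1, fun p v hv e => by simp [evalAt]⟩

variable {K r}

/-- Relabelling along an injection preserves linear generality. -/
theorem IsLinearlyGeneral.comp {ι κ : Type*} {p : ι → ℙ K (Fin r → K)}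
    (hp : IsLinearlyGeneral K r p) (e : κ ↪ ι) : IsLinearlyGeneral K r (p ∘ e) := by
  intro s hs
  have h := Projectivization.independent_iff.1 (hp (s.map e) (by simpa using hs))
  rw [Projectivization.independent_iff]
  exact h.comp (fun i : s => ⟨e i, by simp⟩) fun i j hij => by
    exact Subtype.ext (e.injective (congrArg Subtype.val hij))

/-- The forgetful map `fgt_I : X(r, ι) → X(r, I)` for `I ⊆ ι`. -/
def forget {ι : Type*} (I : Finset ι) : ConfigSpace K r ι → ConfigSpace K r I :=
  Quotient.map' (s₁ := configSetoid K r ι) (s₂ := configSetoid K r I)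
    (fun p => ⟨fun i : I => p.1 i, p.2.comp (Function.Embedding.subtype (· ∈ I))⟩)
    (by
      rintro p q ⟨g, hg⟩
      exact ⟨g, funext fun i => congrFun hg i⟩)

theorem evalAt_rename {ι : Type*} (I : Finset ι) (v : ι → Fin r → K)
    (P : MvPolynomial (I × Fin r) K) :
    evalAt v (MvPolynomial.rename (fun x : I × Fin r => ((x.1 : ι), x.2)) P) =
      evalAt (fun i : I => v i) P := by
  simp only [evalAt, MvPolynomial.eval_rename]
  rfl

theorem isMorphism_forget {ι : Type*} (I : Finset ι) :
    IsMorphism (regularFunctions K r ι) (regularFunctions K r I) (forget I) := by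
  rintro f ⟨P, Q, h⟩
  refine ⟨MvPolynomial.rename (fun x : I × Fin r => ((x.1 : ι), x.2)) P,
    MvPolynomial.rename (fun x : I × Fin r => ((x.1 : ι), x.2)) Q, fun p v hv e => ?_⟩
  rw [evalAt_rename, evalAt_rename]
  exact h ⟨fun i : I => p.1 i, p.2.comp (Function.Embedding.subtype (· ∈ I))⟩
    (fun i : I => v i) (fun i => hv i) fun i => e i

/-- The map `fgt_𝓘 : X(r, ι) → ∏ j, X(r, I j)`. -/
def forgetAll {ι J : Type*} (I : J → Finset ι) (x : ConfigSpace K r ι) (j : J) :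
    ConfigSpace K r (I j) :=
  forget (I j) x

theorem isMorphism_forgetAll {ι J : Type*} (I : J → Finset ι) :
    IsMorphism (regularFunctions K r ι) (productRegular fun j => regularFunctions K r (I j))
      (forgetAll I) := by
  intro g hg
  induction hg using Algebra.adjoin_induction with
  | mem g hg =>
    obtain ⟨j, g, hg, rfl⟩ := hg
    exact isMorphism_forget (I j) g hg
  | algebraMap c => exact (regularFunctions K r ι).algebraMap_mem c
  | add f g _ _ hf hg => exact (regularFunctions K r ι).add_mem hf hg
  | mul f g _ _ hf hg => exact (regularFunctions K r ι).mul_mem hf hg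

/-- The product of all maximal minors. -/
def minorProduct (K : Type*) [Field K] (r : ℕ) (ι : Type*) [Fintype ι] [DecidableEq ι] :
    MvPolynomial (ι × Fin r) K :=
  ∏ e : Fin r ↪ ι, Matrix.det (Matrix.of fun a b => MvPolynomial.X (e a, b))

theorem evalAt_minorProduct {ι : Type*} [Fintype ι] [DecidableEq ι] (v : ι → Fin r → K) :
    evalAt v (minorProduct K r ι) = ∏ e : Fin r ↪ ι, Matrix.det (Matrix.of fun a => v (e a)) := by
  unfold evalAt minorProduct
  rw [map_prod]
  refine Finset.prod_congr rfl fun e _ => ?_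
  rw [RingHom.map_det]
  congr 1
  ext a b
  simp

theorem linearIndependent_of_minorProduct {ι : Type*} [Fintype ι] [DecidableEq ι]
    (hι : r ≤ Fintype.card ι) (v : ι → Fin r → K) (h : evalAt v (minorProduct K r ι) ≠ 0)
    (s : Finset ι) (hs : s.card ≤ r) : LinearIndependent K fun i : s => v i := by
  rw [evalAt_minorProduct, Finset.prod_ne_zero_iff] at h
  obtain ⟨t, hst, ht⟩ := Finset.exists_superset_card_eq hs hι
  let u := (t.equivFinOfCardEq ht).symm
  have hdet := h (u.toEmbedding.trans (Function.Embedding.subtype _)) (Finset.mem_univ _)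
  have hli := Matrix.linearIndependent_rows_iff_isUnit.2
    ((Matrix.isUnit_iff_isUnit_det _).2 (isUnit_iff_ne_zero.2 hdet))
  have := hli.comp (fun i : s => u.symm ⟨i, hst i.2⟩) fun i j hij =>
    Subtype.ext (Subtype.mk.inj (u.symm.injective hij))
  convert this using 1
  funext i
  change v i = v (u (u.symm ⟨i, hst i.2⟩))
  rw [Equiv.apply_symm_apply]

theorem exists_config_of_minorProduct {ι : Type*} [Fintype ι] [DecidableEq ι] (hr : 1 ≤ r)
    (hι : r ≤ Fintype.card ι) (v : ι → Fin r → K) (h : evalAt v (minorProduct K r ι) ≠ 0) :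
    ∃ (p : GeneralConfig K r ι) (hv : ∀ i, v i ≠ 0),
      ∀ i, Projectivization.mk K (v i) (hv i) = p.1 i := by
  have key := linearIndependent_of_minorProduct hι v h
  have hv : ∀ i, v i ≠ 0 := fun i =>
    (key {i} (by simpa using hr)).ne_zero ⟨i, Finset.mem_singleton_self i⟩
  exact ⟨⟨fun i => Projectivization.mk K (v i) (hv i), fun s hs =>
    Projectivization.Independent.mk _ (fun i : s => hv i) (key s hs)⟩, hv, fun _ => rfl⟩

theorem exists_evalAt_minorProduct_ne_zero [Infinite K] {ι : Type*} [Fintype ι] [DecidableEq ι] :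
    ∃ v : ι → Fin r → K, evalAt v (minorProduct K r ι) ≠ 0 := by
  let x : ι ↪ K := ((Fintype.equivFin ι).toEmbedding.trans Fin.valEmbedding).trans
    (Infinite.natEmbedding K)
  refine ⟨fun i a => x i ^ (a : ℕ), ?_⟩
  rw [evalAt_minorProduct, Finset.prod_ne_zero_iff]
  intro e _
  exact Matrix.det_vandermonde_ne_zero_iff.2 (x.injective.comp e.injective)

/-- `X(r, ι)` is irreducible as soon as there are at least `r` labels. -/
theorem isDomain_regularFunctions [Infinite K] {ι : Type*} [Fintype ι] [DecidableEq ι]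
    (hr : 1 ≤ r) (hι : r ≤ Fintype.card ι) : IsDomain (regularFunctions K r ι) := by
  obtain ⟨v₀, hv₀⟩ := exists_evalAt_minorProduct_ne_zero (K := K) (r := r) (ι := ι)
  have hD : minorProduct K r ι ≠ 0 := by
    intro h
    rw [h] at hv₀
    simp [evalAt] at hv₀
  obtain ⟨p₀, -, -⟩ := exists_config_of_minorProduct hr hι v₀ hv₀
  have : Nontrivial (regularFunctions K r ι) :=
    ⟨0, 1, fun h => zero_ne_one (congrFun (congrArg Subtype.val h) (ConfigSpace.mk p₀))⟩
  have hz : ∀ (f : ConfigSpace K r ι → K) (Q : MvPolynomial (ι × Fin r) K),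
      (∀ (p : GeneralConfig K r ι) (v : ι → Fin r → K) (hv : ∀ i, v i ≠ 0),
      (∀ i, Projectivization.mk K (v i) (hv i) = p.1 i) →
        evalAt v Q ≠ 0 ∧ f (ConfigSpace.mk p) = evalAt v 0 / evalAt v Q) → f = 0 := by
    intro f Q h
    funext x
    obtain ⟨p, rfl⟩ := Quotient.exists_rep x
    refine (h p (fun i => (p.1 i).rep) (fun i => (p.1 i).rep_nonzero)
      fun i => (p.1 i).mk_rep).2.trans ?_
    simp only [evalAt, map_zero, zero_div]
    rfl
  have : NoZeroDivisors (regularFunctions K r ι) := by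
    refine ⟨?_⟩
    rintro ⟨f, P, Q, h⟩ ⟨g, P', Q', h'⟩ hfg
    have hfg' : ∀ x, f x * g x = 0 := fun x => congrFun (congrArg Subtype.val hfg) x
    have hP : P * P' * minorProduct K r ι = 0 := by
      refine MvPolynomial.funext fun w => ?_
      let v : ι → Fin r → K := fun i a => w (i, a)
      change evalAt v (P * P' * minorProduct K r ι) = evalAt v 0
      have hmul : evalAt v (P * P' * minorProduct K r ι) =
          evalAt v P * evalAt v P' * evalAt v (minorProduct K r ι) := by simp [evalAt]
      have hzero : evalAt v (0 : MvPolynomial (ι × Fin r) K) = 0 := by simp [evalAt]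
      rw [hmul, hzero]
      by_cases hv : evalAt v (minorProduct K r ι) = 0
      · rw [hv, mul_zero]
      · obtain ⟨p, hv0, hp⟩ := exists_config_of_minorProduct hr hι v hv
        obtain ⟨h1, h2⟩ := h p v hv0 hp
        obtain ⟨h1', h2'⟩ := h' p v hv0 hp
        have := hfg' (ConfigSpace.mk p)
        rw [h2, h2', div_mul_div_comm, div_eq_zero_iff] at this
        rw [this.resolve_right (mul_ne_zero h1 h1'), zero_mul]
    rcases mul_eq_zero.1 ((mul_eq_zero.1 hP).resolve_right hD) with h0 | h0
    · subst h0
      exact Or.inl (Subtype.ext (hz f Q h))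
    · subst h0
      exact Or.inr (Subtype.ext (hz g Q' h'))
  exact NoZeroDivisors.to_isDomain _

end Space

/-- The projective configuration count `d_{r,n}(𝓘)`, the degree of
`fgt_𝓘 : X(r, [n]) → ∏ j, X(r, I j)`, where `j` runs over `[k]` with `k = n - r - 1`. -/
def configCount (K : Type*) [Field K] [Infinite K] (r n : ℕ) (hr : 2 ≤ r)
    (hn : r + 1 ≤ n) (I : Fin (n - r - 1) → Finset (Fin n)) : ℕ :=
  haveI : IsDomain (regularFunctions K r (Fin n)) :=
    isDomain_regularFunctions (by omega) (by rw [Fintype.card_fin]; omega)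
  degree (regularFunctions K r (Fin n)) (productRegular fun j => regularFunctions K r (I j))
    (forgetAll I) (isMorphism_forgetAll I)

/-- The surplus condition: `|⋃_{j ∈ J} I_j| ≥ |J| + r + 1` for every nonempty `J ⊆ [k]`. -/
def SurplusCondition (r n : ℕ) (I : Fin (n - r - 1) → Finset (Fin n)) : Prop :=
  ∀ J : Finset (Fin (n - r - 1)), J.Nonempty → J.card + r + 1 ≤ (J.biUnion I).card

end ProjConfig

end

/-!
A nonzero degree means that the forgetful map is dominant, so the theorem is a dimension count. For
a set `T` of `m ≥ 1` indices let `S` be the union of the sets `I j`, `j ∈ T`. The components of the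
forgetful map with `j ∈ T` factor through `X(r, S)`, which has dimension `(r - 1) (|S| - r - 1)`,
while their joint target has dimension `(r - 1) m`. If `|S| < m + r + 1`, the target is too large
for the map to be dominant.

The count is made explicit with cross-ratios. A configuration of `r + 2` points has `r - 1`
cross-ratios, which are quotients of products of maximal minors and hence regular
(`isRegular_crossRatio`). In the normal form whose first `r` points are the standard basis, whose
next point is `(1, …, 1)`, and whose last point has a coordinate equal to `1`, they are the other
coordinates of that last point; these can be prescribed generically. So the `(r - 1) m`
cross-ratios of the sets `I j` are algebraically independent on the product
(`exists_eval_crossRatio_ne_zero`).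

On the other hand, every configuration labelled by `S` has a normal form with
`(r - 1) (|S| - r - 1)` parameters (`exists_normal_form`), and the cross-ratios are rational
functions of these parameters. A transcendence degree argument
(`exists_polynomial_relation_of_card_lt`) gives a polynomial relation between them as soon as
`|S| - r - 1 < m` (`exists_relation_crossRatio`). Applied to the cross-ratios on the product, this
relation is a nonzero regular function vanishing on the image of the forgetful map, which
contradicts dominance (`card_biUnion_of_isDominant`).
-/

/-! ### Relations between rational functions -/

open MvPolynomial in
/-- More than `#σ` fractions of polynomials in the variables `σ` satisfy a common nonzero polynomial
relation, which holds at every point where all the denominators are nonzero. -/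
theorem exists_polynomial_relation_of_card_lt {K : Type*} [Field K] {σ τ : Type} [Fintype σ]
    [Fintype τ] (hcard : Fintype.card σ < Fintype.card τ) (P Q : τ → MvPolynomial σ K)
    (hQ : ∀ i, Q i ≠ 0) :
    ∃ F : MvPolynomial τ K, F ≠ 0 ∧ ∀ t : σ → K, (∀ i, eval t (Q i) ≠ 0) →
      eval (fun i => eval t (P i) / eval t (Q i)) F = 0 := by
  let D := ∏ i, Q i
  have hD : D ≠ 0 := Finset.prod_ne_zero_iff.2 fun i _ => hQ i
  let L := Localization.Away D
  have hle : Submonoid.powers D ≤ nonZeroDivisors (MvPolynomial σ K) :=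
    powers_le_nonZeroDivisors_of_noZeroDivisors hD
  have : IsDomain L := IsLocalization.isDomain_localization hle
  have hinj : Function.Injective (algebraMap (MvPolynomial σ K) L) :=
    IsLocalization.injective L hle
  have : FaithfulSMul (MvPolynomial σ K) L := (faithfulSMul_iff_algebraMap_injective _ _).2 hinj
  have : Algebra.IsAlgebraic (MvPolynomial σ K) L :=
    IsLocalization.isAlgebraic L (Submonoid.powers D)
  have hunit : ∀ i, IsUnit (algebraMap (MvPolynomial σ K) L (Q i)) := fun i =>
    isUnit_of_dvd_unit (map_dvd _ (Finset.dvd_prod_of_mem Q (Finset.mem_univ i)))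
      (IsLocalization.Away.algebraMap_isUnit D)
  choose θ hθ using fun i => (hunit i).dvd (a := algebraMap (MvPolynomial σ K) L (P i))
  -- `L` is algebraic over the polynomial ring and so has transcendence degree `#σ`; hence the
  -- fractions `θ i` cannot be independent.
  have htr : Algebra.trdeg K L = Cardinal.lift (Cardinal.mk σ) := by
    rw [← trdeg_add_eq K (MvPolynomial σ K) (A := L), trdeg_of_isDomain,
      trdeg_eq_zero, add_zero]
  have hdep : ¬ AlgebraicIndependent K θ := fun h => by
    have := h.lift_cardinalMk_le_trdeg
    rw [htr] at this
    simp at this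
    omega
  rw [algebraicIndependent_iff] at hdep
  push Not at hdep
  obtain ⟨F, hF, hF0⟩ := hdep
  refine ⟨F, hF0, fun t ht => ?_⟩
  have hDt : IsUnit (eval t D) := by
    rw [isUnit_iff_ne_zero, map_prod]
    exact Finset.prod_ne_zero_iff.2 fun i _ => ht i
  let φ : L →+* K := IsLocalization.Away.lift D hDt
  have hφ : ∀ p, φ (algebraMap _ L p) = eval t p := IsLocalization.Away.lift_eq D hDt
  have hφθ : ∀ i, φ (θ i) = eval t (P i) / eval t (Q i) := fun i => by
    rw [eq_div_iff (ht i), mul_comm, ← hφ, ← hφ, ← map_mul, ← hθ]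
  have := congrArg φ hF
  rw [map_zero, aeval_def, hom_eval₂] at this
  simp only [← hφθ]
  rw [← this, eval, coe_eval₂Hom]
  congr 1
  ext c
  change c = φ (algebraMap K L c)
  rw [IsScalarTower.algebraMap_apply K (MvPolynomial σ K) L, hφ, algebraMap_eq, eval_C]

namespace ProjConfig

/-! ### Minors and cross-ratios -/

section Minors

variable {R : Type*} [CommRing R] {r : ℕ} {ι : Type*}

/-- The maximal minor of the family of row vectors `v` on the rows `e`. -/
def minor (v : ι → Fin r → R) (e : Fin r → ι) : R :=
  Matrix.det (Matrix.of fun a => v (e a))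

theorem map_minor {S : Type*} [CommRing S] (f : R →+* S) (v : ι → Fin r → R) (e : Fin r → ι) :
    f (minor v e) = minor (fun i b => f (v i b)) e := by
  rw [minor, RingHom.map_det]
  rfl

theorem minor_update (v : ι → Fin r → R) (e : Fin r → ι) (a : Fin r) (i : ι) :
    minor v (Function.update e a i) = ((Matrix.of fun a => v (e a)).updateRow a (v i)).det := by
  unfold minor
  congr 1
  ext b c
  by_cases h : b = a
  · subst h; simp
  · simp [h]

/-- A minor of transformed and rescaled vectors is a multiple of the original minor. -/
theorem minor_smul_mulVec (c : ι → R) (g : Matrix (Fin r) (Fin r) R) (v : ι → Fin r → R)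
    (e : Fin r → ι) :
    minor (fun i => c i • g.mulVec (v i)) e = (∏ a, c (e a)) * (minor v e * g.det) := by
  have h : (Matrix.of fun a => c (e a) • g.mulVec (v (e a))) =
      Matrix.of fun a b => c (e a) * ((Matrix.of fun a => v (e a)) * g.transpose) a b := by
    ext a b
    simp [Matrix.mul_apply, Matrix.mulVec, dotProduct, mul_comm]
  rw [minor, h, Matrix.det_mul_column, Matrix.det_mul, Matrix.det_transpose]
  rfl

/-- The labels of `r + 2` points of `ℙ^{r-1}`: a frame of `r` vectors `some (some a)`, a unit point
`some none`, and a further point `none`. -/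
abbrev Labels (r : ℕ) : Type := Option (Option (Fin r))

/-- The numerator of the cross-ratio `(t a / u a) / (t l / u l)`, where `u` and `t` are the
coordinates of the unit point and of the further point in the frame given by the other vectors. -/
def crossNum (l a : Fin r) (w : Labels r → Fin r → R) : R :=
  minor w (Function.update (fun b => some (some b)) a none) *
    minor w (Function.update (fun b => some (some b)) l (some none))

/-- The denominator of the cross-ratio with numerator `crossNum l a w`. -/
def crossDen (l a : Fin r) (w : Labels r → Fin r → R) : R :=
  minor w (Function.update (fun b => some (some b)) a (some none)) *
    minor w (Function.update (fun b => some (some b)) l none)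

theorem map_crossNum {S : Type*} [CommRing S] (f : R →+* S) (l a : Fin r)
    (w : Labels r → Fin r → R) : f (crossNum l a w) = crossNum l a fun o b => f (w o b) := by
  simp only [crossNum, map_mul, map_minor]

theorem map_crossDen {S : Type*} [CommRing S] (f : R →+* S) (l a : Fin r)
    (w : Labels r → Fin r → R) : f (crossDen l a w) = crossDen l a fun o b => f (w o b) := by
  simp only [crossDen, map_mul, map_minor]

/-- The factor by which `crossNum` and `crossDen` both change is the same: each label of the frame
and both other labels occur equally often in the two products of minors. -/
theorem exists_cross_smul_mulVec (l a : Fin r) (c : Labels r → R) (g : Matrix (Fin r) (Fin r) R)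
    (w : Labels r → Fin r → R) :
    ∃ κ, crossNum l a (fun o => c o • g.mulVec (w o)) = κ * crossNum l a w ∧
      crossDen l a (fun o => c o • g.mulVec (w o)) = κ * crossDen l a w := by
  have hp : ∀ (b : Fin r) (o : Labels r),
      ∏ x, c (Function.update (fun b => some (some b)) b o x) =
        c o * ∏ x ∈ Finset.univ \ {b}, c (some (some x)) := by
    intro b o
    rw [← Finset.prod_update_of_mem (Finset.mem_univ b) (fun x => c (some (some x))) (c o)]
    refine Finset.prod_congr rfl fun x _ => ?_
    by_cases h : x = b
    · subst h; simp
    · simp [h]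
  refine ⟨c none * c (some none) * g.det ^ 2 * (∏ x ∈ Finset.univ \ {a}, c (some (some x))) *
    ∏ x ∈ Finset.univ \ {l}, c (some (some x)), ?_, ?_⟩
  · simp only [crossNum, minor_smul_mulVec, hp]; ring
  · simp only [crossDen, minor_smul_mulVec, hp]; ring

/-- In normal form the cross-ratios are the coordinates of the last point. -/
theorem cross_of_normal (l a : Fin r) (w : Labels r → Fin r → R)
    (hframe : ∀ b, w (some (some b)) = Pi.single b 1) (hunit : w (some none) = 1)
    (hl : w none l = 1) : crossNum l a w = w none a ∧ crossDen l a w = 1 := by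
  have h : ∀ b o, minor w (Function.update (fun b => some (some b)) b o) = w o b := by
    intro b o
    have h1 : (Matrix.of fun a => w (some (some a))) = (1 : Matrix (Fin r) (Fin r) R) := by
      ext i j
      simp [hframe, Matrix.one_apply, Pi.single_apply, eq_comm]
    rw [minor_update, h1, ← Matrix.cramer_transpose_apply, Matrix.transpose_one, Matrix.cramer_one]
    rfl
  simp [crossNum, crossDen, h, hunit, hl]

theorem update_frame_injective (b : Fin r) {o : Labels r} (ho : ∀ b, o ≠ some (some b)) :
    Function.Injective (Function.update (fun b => (some (some b) : Labels r)) b o) := by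
  intro x y hxy
  by_cases hx : x = b <;> by_cases hy : y = b
  · rw [hx, hy]
  · subst hx
    simp [hy] at hxy
    exact absurd hxy (ho y)
  · subst hy
    simp [hx] at hxy
    exact absurd hxy.symm (ho x)
  · simpa [hx, hy] using hxy

theorem crossDen_ne_zero [IsDomain R] (l a : Fin r) (v : ι → Fin r → R)
    (hv : ∀ e : Fin r ↪ ι, minor v e ≠ 0) (ε : Labels r ↪ ι) :
    crossDen l a (fun o => v (ε o)) ≠ 0 := by
  have h : ∀ (b : Fin r) (o : Labels r), (∀ b, o ≠ some (some b)) →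
      minor (fun o => v (ε o)) (Function.update (fun b => some (some b)) b o) ≠ 0 := fun b o ho =>
    hv ⟨fun x => ε (Function.update (fun b => some (some b)) b o x),
      ε.injective.comp (update_frame_injective b ho)⟩
  exact mul_ne_zero (h _ _ (by simp)) (h _ _ (by simp))

end Minors

/-! ### Normal forms of configurations -/

section NormalForm

variable {R : Type*} [CommRing R] {r : ℕ} {ι : Type*}

/-- The parameters of the normal form: the coordinates other than the `l`-th of the points outside
the frame and the unit point, whose labels are given by `φ`. -/
abbrev Param (φ : Option (Fin r) ↪ ι) (l : Fin r) : Type _ :=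
  {i : ι // i ∉ Set.range φ} × {a : Fin r // a ≠ l}

open Classical in
/-- The family of vectors in normal form with parameters `t`: the standard basis at the frame, the
vector `(1, …, 1)` at the unit point, and vectors with `l`-th coordinate `1` elsewhere. -/
noncomputable def normVec (φ : Option (Fin r) ↪ ι) (l : Fin r) (t : Param φ l → R) :
    ι → Fin r → R :=
  Function.extend φ (fun o => o.elim 1 fun a => Pi.single a 1) fun i b =>
    if h : i ∉ Set.range φ ∧ b ≠ l then t (⟨i, h.1⟩, ⟨b, h.2⟩) else 1

variable (φ : Option (Fin r) ↪ ι) (l : Fin r) (t : Param φ l → R)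

theorem normVec_frame (a : Fin r) : normVec φ l t (φ (some a)) = Pi.single a 1 :=
  φ.injective.extend_apply _ _ _

theorem normVec_unit : normVec φ l t (φ none) = 1 :=
  φ.injective.extend_apply _ _ _

theorem normVec_of_notMem {i : ι} (hi : i ∉ Set.range φ) (b : Fin r) :
    normVec φ l t i b = if h : b ≠ l then t (⟨i, hi⟩, ⟨b, h⟩) else 1 := by
  rw [normVec, Function.extend_apply' _ _ _ hi]
  simp [hi]

theorem map_normVec {S : Type*} [CommRing S] (f : R →+* S) (i : ι) (b : Fin r) :
    f (normVec φ l t i b) = normVec φ l (fun x => f (t x)) i b := by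
  by_cases hi : i ∈ Set.range φ
  · obtain ⟨_ | a, rfl⟩ := hi
    · simp [normVec_unit]
    · simp only [normVec_frame, Pi.single_apply]
      split_ifs <;> simp
  · simp only [normVec_of_notMem _ _ _ hi]
    split_ifs <;> simp

/-- Vectors all of whose maximal minors are nonzero can be put into normal form by a linear
transformation and rescaling. -/
theorem exists_normal_form {K : Type*} [Field K] (φ : Option (Fin r) ↪ ι) (l : Fin r)
    (v : ι → Fin r → K) (hv : ∀ e : Fin r ↪ ι, minor v e ≠ 0) :
    ∃ (g : Matrix (Fin r) (Fin r) K) (c : ι → K) (t : Param φ l → K),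
      g.det ≠ 0 ∧ (∀ i, c i ≠ 0) ∧ ∀ i, c i • g.mulVec (v i) = normVec φ l t i := by
  classical
  let e : Fin r ↪ ι := Function.Embedding.some.trans φ
  let M : Matrix (Fin r) (Fin r) K := Matrix.of fun a => v (e a)
  have hM : M.det ≠ 0 := hv e
  -- By Cramer's rule, `x` gives the coordinates in the frame, multiplied by `M.det`.
  let x : ι → Fin r → K := fun i => M.transpose.adjugate.mulVec (v i)
  have hx : ∀ i a, x i a = minor v (Function.update e a i) := fun i a => by
    rw [minor_update, ← Matrix.cramer_transpose_apply, Matrix.cramer_eq_adjugate_mulVec]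
  have hxe : ∀ a, x (e a) = Pi.single a M.det := fun a => by
    change M.transpose.adjugate.mulVec (M a) = _
    rw [← Matrix.cramer_eq_adjugate_mulVec, Matrix.cramer_transpose_row_self]
  have hx0 : ∀ i, (∀ a, i ≠ e a) → ∀ a, x i a ≠ 0 := by
    intro i hi a
    rw [hx]
    refine hv ⟨Function.update e a i, fun p q hpq => ?_⟩
    by_cases hp : p = a <;> by_cases hq : q = a
    · rw [hp, hq]
    · subst hp
      simp [hq] at hpq
      exact absurd hpq (hi q)
    · subst hq
      simp [hp] at hpq
      exact absurd hpq.symm (hi p)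
    · simpa [hp, hq] using hpq
  let u : Fin r → K := x (φ none)
  have hu : ∀ a, u a ≠ 0 := hx0 _ fun a h => by simpa [e] using φ.injective h
  let g : Matrix (Fin r) (Fin r) K := Matrix.diagonal (fun a => (u a)⁻¹) * M.transpose.adjugate
  have hg : ∀ i, g.mulVec (v i) = fun a => (u a)⁻¹ * x i a := fun i => by
    ext a
    rw [← Matrix.mulVec_mulVec, Matrix.mulVec_diagonal]
  have hout : ∀ i, i ∉ Set.range φ → ∀ a, x i a ≠ 0 := fun i hi =>
    hx0 i fun a h => hi ⟨some a, h.symm⟩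
  let c : ι → K := Function.extend φ (fun o => o.elim 1 fun a => u a / M.det)
    fun i => if i ∈ Set.range φ then 1 else u l / x i l
  have hcφ : ∀ o, c (φ o) = o.elim 1 fun a => u a / M.det := φ.injective.extend_apply _ _
  have hci : ∀ i, i ∉ Set.range φ → c i = u l / x i l := fun i hi => by
    rw [show c i = _ from Function.extend_apply' _ _ _ hi, if_neg hi]
  refine ⟨g, c, fun y => c y.1 * ((u y.2)⁻¹ * x y.1 y.2), ?_, ?_, ?_⟩
  · rw [Matrix.det_mul, Matrix.det_diagonal, Matrix.det_adjugate, Matrix.det_transpose]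
    exact mul_ne_zero (Finset.prod_ne_zero_iff.2 fun a _ => inv_ne_zero (hu a)) (pow_ne_zero _ hM)
  · intro i
    by_cases hi : i ∈ Set.range φ
    · obtain ⟨_ | a, rfl⟩ := hi
      · rw [hcφ]; exact one_ne_zero
      · rw [hcφ]; exact div_ne_zero (hu a) hM
    · rw [hci i hi]; exact div_ne_zero (hu l) (hout i hi l)
  · intro i
    rw [hg]
    by_cases hi : i ∈ Set.range φ
    · obtain ⟨_ | a, rfl⟩ := hi
      · rw [hcφ, normVec_unit]
        ext a
        simp only [Option.elim, one_smul, Pi.one_apply]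
        exact inv_mul_cancel₀ (hu a)
      · rw [hcφ, normVec_frame]
        ext b
        have := congrFun (hxe a) b
        change x (φ (some a)) b = _ at this
        simp only [Option.elim, Pi.smul_apply, smul_eq_mul, this]
        by_cases hb : b = a
        · subst hb
          have := hu b
          simp only [Pi.single_eq_same]
          field_simp
        · simp [hb]
    · ext b
      rw [normVec_of_notMem _ _ _ hi, Pi.smul_apply, smul_eq_mul]
      split_ifs with hb
      · rfl
      · rw [not_not] at hb
        subst hb
        rw [hci i hi]
        have := hout i hi b
        have := hu b
        field_simp

end NormalForm

/-! ### Cross-ratios as regular functions -/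

section Regular

variable {K : Type*} [Field K] {r : ℕ} {ι : Type*}

theorem minor_ne_zero_of_general (p : GeneralConfig K r ι) (v : ι → Fin r → K)
    (hv : ∀ i, v i ≠ 0) (hp : ∀ i, Projectivization.mk K (v i) (hv i) = p.1 i)
    (e : Fin r ↪ ι) : minor v e ≠ 0 := by
  have h := Projectivization.independent_iff.1 (p.2 (Finset.univ.map e) (by simp))
  have h1 : LinearIndependent K fun a => (p.1 (e a)).rep :=
    h.comp (fun a => ⟨e a, by simp⟩) fun a b hab => e.injective (congrArg Subtype.val hab)
  choose c hc using fun i => Projectivization.exists_smul_eq_mk_rep K (v i) (hv i)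
  have h2 : LinearIndependent K fun a => v (e a) := by
    rw [← LinearIndependent.units_smul_iff (w := fun a => c (e a))]
    convert h1 using 1
    funext a
    rw [← hp, ← hc]
    rfl
  exact ((Matrix.isUnit_iff_isUnit_det _).1
    (Matrix.linearIndependent_rows_iff_isUnit (A := Matrix.of fun a => v (e a)).1 h2)).ne_zero

/-- Cross-ratios depend on the configuration only, up to projective equivalence. -/
theorem cross_eq_of_equiv (ε : Labels r ↪ ι) (l a : Fin r) (p q : GeneralConfig K r ι)
    (hpq : configSetoid K r ι p q) (v w : ι → Fin r → K)
    (hv : ∀ i, v i ≠ 0) (hp : ∀ i, Projectivization.mk K (v i) (hv i) = p.1 i)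
    (hw : ∀ i, w i ≠ 0) (hq : ∀ i, Projectivization.mk K (w i) (hw i) = q.1 i) :
    crossNum l a (fun o => v (ε o)) / crossDen l a (fun o => v (ε o)) =
      crossNum l a (fun o => w (ε o)) / crossDen l a (fun o => w (ε o)) := by
  obtain ⟨g, hg⟩ := hpq
  obtain ⟨g, rfl⟩ := Matrix.ProjGenLinGroup.mk_surjective g
  have hc : ∀ i, ∃ c : K, c • (g : Matrix (Fin r) (Fin r) K).mulVec (w i) = v i := by
    intro i
    have h := congrFun hg i
    change (Matrix.ProjGenLinGroup.mk g : PGL(Fin r, K)) • q.1 i = p.1 i at h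
    rw [← hp, ← hq, Projectivization.PGL.mk_smul_mk, eq_comm, Projectivization.mk_eq_mk_iff'] at h
    exact h
  choose c hc using hc
  obtain rfl : (fun i => c i • (g : Matrix (Fin r) (Fin r) K).mulVec (w i)) = v := funext hc
  obtain ⟨κ, h1, h2⟩ := exists_cross_smul_mulVec l a (fun o => c (ε o)) g fun o => w (ε o)
  have h3 := crossDen_ne_zero l a _ (minor_ne_zero_of_general p _ hv hp) ε
  rw [h2] at h3
  rw [h1, h2, mul_div_mul_left _ _ (left_ne_zero_of_mul h3)]

/-- The `a`-th cross-ratio, relative to the `l`-th coordinate, of the `r + 2` points of a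
configuration selected by `ε`. -/
noncomputable def crossRatio (ε : Labels r ↪ ι) (l a : Fin r) (x : ConfigSpace K r ι) : K :=
  crossNum l a (fun o => ((Quotient.out x).1 (ε o)).rep) /
    crossDen l a (fun o => ((Quotient.out x).1 (ε o)).rep)

theorem crossRatio_mk (ε : Labels r ↪ ι) (l a : Fin r) (p : GeneralConfig K r ι)
    (v : ι → Fin r → K) (hv : ∀ i, v i ≠ 0)
    (hp : ∀ i, Projectivization.mk K (v i) (hv i) = p.1 i) :
    crossRatio ε l a (ConfigSpace.mk p) =
      crossNum l a (fun o => v (ε o)) / crossDen l a (fun o => v (ε o)) :=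
  cross_eq_of_equiv ε l a _ p (Quotient.mk_out (s := configSetoid K r ι) p) _ v
    (fun _ => Projectivization.rep_nonzero _) (fun _ => Projectivization.mk_rep _) hv hp

theorem isRegular_crossRatio (ε : Labels r ↪ ι) (l a : Fin r) :
    crossRatio ε l a ∈ regularFunctions K r ι := by
  refine ⟨crossNum l a fun o b => MvPolynomial.X (ε o, b),
    crossDen l a fun o b => MvPolynomial.X (ε o, b), fun p v hv hp => ?_⟩
  simp only [evalAt, map_crossNum, map_crossDen, MvPolynomial.eval_X]
  exact ⟨crossDen_ne_zero l a v (minor_ne_zero_of_general p v hv hp) ε,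
    crossRatio_mk ε l a p v hv hp⟩

end Regular

/-! ### Independence of the cross-ratios on a product -/

section Independent

variable {K : Type*} [Field K] {r : ℕ}

theorem evalAt_minorProduct_ne_zero_iff {ι : Type*} [Fintype ι] [DecidableEq ι]
    (v : ι → Fin r → K) :
    evalAt v (minorProduct K r ι) ≠ 0 ↔ ∀ e : Fin r ↪ ι, minor v e ≠ 0 := by
  rw [evalAt_minorProduct, Finset.prod_ne_zero_iff]
  simp [minor]

/-- The family in normal form is linearly general for generic parameters. -/
theorem exists_polynomial_normVec_general [Infinite K] {ι : Type*} [Fintype ι]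
    (φ : Option (Fin r) ↪ ι) (l : Fin r) :
    ∃ G : MvPolynomial (Param φ l) K, G ≠ 0 ∧ ∀ t, MvPolynomial.eval t G ≠ 0 →
      ∀ e : Fin r ↪ ι, minor (normVec φ l t) e ≠ 0 := by
  classical
  refine ⟨∏ e : Fin r ↪ ι, minor (normVec φ l MvPolynomial.X) e, ?_, ?_⟩
  · -- The normal form of a linearly general family is again linearly general.
    obtain ⟨v, hv⟩ := exists_evalAt_minorProduct_ne_zero (K := K) (r := r) (ι := ι)
    rw [evalAt_minorProduct_ne_zero_iff] at hv
    obtain ⟨g, c, t, hg, hc, h⟩ := exists_normal_form φ l v hv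
    rw [Finset.prod_ne_zero_iff]
    intro e _ h0
    have h1 := congrArg (MvPolynomial.eval t) h0
    simp only [map_minor, map_normVec, MvPolynomial.eval_X, map_zero] at h1
    change minor (normVec φ l t) e = 0 at h1
    rw [← funext h, minor_smul_mulVec] at h1
    exact mul_ne_zero (Finset.prod_ne_zero_iff.2 fun a _ => hc (e a)) (mul_ne_zero (hv e) hg) h1
  · intro t ht e
    rw [map_prod, Finset.prod_ne_zero_iff] at ht
    have := ht e (Finset.mem_univ _)
    simp only [map_minor, map_normVec, MvPolynomial.eval_X] at this
    exact this

/-- The cross-ratios of `r + 2` points take all values outside a hypersurface. -/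
theorem exists_polynomial_crossRatio_surjective [Infinite K] (hr : 1 ≤ r) (l : Fin r) :
    ∃ G : MvPolynomial {a : Fin r // a ≠ l} K, G ≠ 0 ∧ ∀ t, MvPolynomial.eval t G ≠ 0 →
      ∀ {ι : Type} (ε : Labels r ≃ ι), ∃ x : ConfigSpace K r ι,
        ∀ a : {a : Fin r // a ≠ l}, crossRatio ε.toEmbedding l a x = t a := by
  classical
  obtain ⟨G, hG, h⟩ := exists_polynomial_normVec_general (K := K)
    (Function.Embedding.some : Option (Fin r) ↪ Labels r) l
  have hnone : (none : Labels r) ∉ Set.range (Function.Embedding.some : Option (Fin r) ↪ _) := by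
    rintro ⟨_, h⟩
    cases h
  have hinj : Function.Injective (Prod.snd : Param (Function.Embedding.some :
      Option (Fin r) ↪ Labels r) l → _) := by
    rintro ⟨⟨o, ho⟩, a⟩ ⟨⟨o', ho'⟩, a'⟩ (rfl : a = a')
    obtain rfl : o = none := by
      by_contra h
      obtain ⟨b, rfl⟩ := Option.ne_none_iff_exists'.1 h
      exact ho ⟨b, rfl⟩
    obtain rfl : o' = none := by
      by_contra h
      obtain ⟨b, rfl⟩ := Option.ne_none_iff_exists'.1 h
      exact ho' ⟨b, rfl⟩
    rfl
  refine ⟨MvPolynomial.rename Prod.snd G, fun h0 => hG (MvPolynomial.rename_injective _ hinj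
    (by rw [h0, map_zero])), fun t ht ι ε => ?_⟩
  rw [MvPolynomial.eval_rename] at ht
  have hgen := h _ ht
  set w := normVec (Function.Embedding.some : Option (Fin r) ↪ Labels r) l (t ∘ Prod.snd) with hw
  obtain ⟨p, hw0, hp⟩ := exists_config_of_minorProduct hr (by simp; omega) w
    ((evalAt_minorProduct_ne_zero_iff w).2 hgen)
  let q : GeneralConfig K r ι := ⟨fun i => p.1 (ε.symm i), p.2.comp ε.symm.toEmbedding⟩
  refine ⟨ConfigSpace.mk q, fun a => (crossRatio_mk ε.toEmbedding l a q (fun i => w (ε.symm i))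
    (fun i => hw0 _) fun i => hp _).trans ?_⟩
  have hl : w none l = 1 := by simp [hw, normVec_of_notMem _ _ _ hnone]
  have ha : w none a = t a := by simp [hw, normVec_of_notMem _ _ _ hnone, a.2]
  obtain ⟨h1, h2⟩ := cross_of_normal l a w (fun b => normVec_frame _ _ _ b)
    (normVec_unit _ _ _) hl
  simp only [Equiv.toEmbedding_apply, Equiv.symm_apply_apply]
  change crossNum l a w / crossDen l a w = _
  rw [h1, h2, ha, div_one]

/-- No nonzero polynomial in the cross-ratios vanishes on the product of the configuration spaces
of `r + 2` points. -/
theorem exists_eval_crossRatio_ne_zero [Infinite K] (hr : 1 ≤ r) (l : Fin r)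
    {J : Type*} [Fintype J] {Z : J → Type} (ε : ∀ j, Labels r ≃ Z j)
    (F : MvPolynomial (J × {a : Fin r // a ≠ l}) K) (hF : F ≠ 0) :
    ∃ z : ∀ j, ConfigSpace K r (Z j),
      MvPolynomial.eval (fun x => crossRatio (ε x.1).toEmbedding l x.2 (z x.1)) F ≠ 0 := by
  obtain ⟨G, hG, h⟩ := exists_polynomial_crossRatio_surjective (K := K) hr l
  have hne : F * ∏ j : J, MvPolynomial.rename (Prod.mk j) G ≠ 0 :=
    mul_ne_zero hF (Finset.prod_ne_zero_iff.2 fun j _ h0 => hG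
      (MvPolynomial.rename_injective _ (Prod.mk_right_injective j) (by rw [h0, map_zero])))
  obtain ⟨t, ht⟩ :
      ∃ t, MvPolynomial.eval t (F * ∏ j : J, MvPolynomial.rename (Prod.mk j) G) ≠ 0 := by
    by_contra! h0
    exact hne (MvPolynomial.funext fun t => by rw [h0, map_zero])
  rw [map_mul, map_prod] at ht
  have htj : ∀ j, MvPolynomial.eval (fun a => t (j, a)) G ≠ 0 := fun j => by
    have := Finset.prod_ne_zero_iff.1 (right_ne_zero_of_mul ht) j (Finset.mem_univ j)
    rwa [MvPolynomial.eval_rename] at this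
  choose z hz using fun j => h _ (htj j) (ε j)
  refine ⟨z, ?_⟩
  simp only [hz]
  exact left_ne_zero_of_mul ht

end Independent

/-! ### Relations between cross-ratios -/

section Relation

variable {K : Type*} [Field K] {r : ℕ}

/-- A configuration of points labelled by `S` depends on `(r - 1) (|S| - r - 1)` parameters, so
there is a nonzero polynomial relation between any larger number of cross-ratios. -/
theorem exists_relation_crossRatio [Infinite K] (l : Fin r) {S : Type} [Fintype S] {τ : Type}
    [Fintype τ] (ε : τ → Labels r ↪ S) (a : τ → Fin r) (φ : Option (Fin r) ↪ S)
    (hcard : (Fintype.card S - (r + 1)) * (r - 1) < Fintype.card τ) :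
    ∃ F : MvPolynomial τ K, F ≠ 0 ∧ ∀ x : ConfigSpace K r S,
      MvPolynomial.eval (fun i => crossRatio (ε i) l (a i) x) F = 0 := by
  classical
  have hσ : Fintype.card (Param φ l) = (Fintype.card S - (r + 1)) * (r - 1) := by
    have h1 : Fintype.card {i : S // i ∉ Set.range φ} = Fintype.card S - (r + 1) := by
      rw [Fintype.card_subtype_compl]
      congr 1
      exact (Fintype.card_congr (Equiv.ofInjective φ φ.injective).symm).trans (by simp)
    rw [Fintype.card_prod, h1, Fintype.card_subtype_compl]
    simp
  let w : S → Fin r → MvPolynomial (Param φ l) K := normVec φ l MvPolynomial.X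
  obtain ⟨G, hG, hgen⟩ := exists_polynomial_normVec_general (K := K) φ l
  have heval : ∀ (t : Param φ l → K) (i : S) (b : Fin r),
      MvPolynomial.eval t (w i b) = normVec φ l t i b := fun t i b => by
    rw [map_normVec]
    simp only [MvPolynomial.eval_X]
  have hden : ∀ i, crossDen l (a i) (fun o => w (ε i o)) ≠ 0 := by
    obtain ⟨t, ht⟩ : ∃ t, MvPolynomial.eval t G ≠ 0 := by
      by_contra! h0
      exact hG (MvPolynomial.funext fun t => by rw [h0, map_zero])
    intro i h0
    have := congrArg (MvPolynomial.eval t) h0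
    simp only [map_crossDen, heval, map_zero] at this
    exact crossDen_ne_zero l (a i) _ (hgen t ht) (ε i) this
  obtain ⟨F, hF, h⟩ := exists_polynomial_relation_of_card_lt (by rw [hσ]; exact hcard)
    (fun i => crossNum l (a i) fun o => w (ε i o)) (fun i => crossDen l (a i) fun o => w (ε i o))
    hden
  refine ⟨F, hF, fun x => ?_⟩
  obtain ⟨p, rfl⟩ := Quotient.exists_rep x
  change MvPolynomial.eval (fun i => crossRatio (ε i) l (a i) (ConfigSpace.mk p)) F = 0
  let v : S → Fin r → K := fun i => (p.1 i).rep
  have hv : ∀ i, v i ≠ 0 := fun i => (p.1 i).rep_nonzero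
  have hp : ∀ i, Projectivization.mk K (v i) (hv i) = p.1 i := fun i => (p.1 i).mk_rep
  have hminor := minor_ne_zero_of_general p v hv hp
  obtain ⟨g, c, t, hg, hc, ht⟩ := exists_normal_form φ l v hminor
  have hminor' : ∀ e : Fin r ↪ S, minor (normVec φ l t) e ≠ 0 := fun e => by
    rw [← funext ht, minor_smul_mulVec]
    exact mul_ne_zero (Finset.prod_ne_zero_iff.2 fun b _ => hc (e b)) (mul_ne_zero (hminor e) hg)
  have key := h t fun i => by
    simp only [map_crossDen, heval]
    exact crossDen_ne_zero l (a i) _ hminor' (ε i)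
  rw [← key]
  congr 2
  funext i
  rw [crossRatio_mk (ε i) l (a i) p v hv hp]
  simp only [map_crossNum, map_crossDen, heval]
  have hden' := crossDen_ne_zero l (a i) _ hminor' (ε i)
  change _ = crossNum l (a i) (fun o => normVec φ l t (ε i o)) /
    crossDen l (a i) (fun o => normVec φ l t (ε i o))
  obtain ⟨κ, h1, h2⟩ := exists_cross_smul_mulVec l (a i) (fun o => c (ε i o)) g
    fun o => v (ε i o)
  simp only [ht] at h1 h2
  rw [h2] at hden'
  rw [h1, h2, mul_div_mul_left _ _ (left_ne_zero_of_mul hden')]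

end Relation

/-! ### Dominance and the surplus condition -/

section Surplus

variable {K : Type*} [Field K] {r : ℕ}

theorem crossRatio_forget {ι : Type*} (I : Finset ι) (ε : Labels r ↪ I) (l a : Fin r)
    (x : ConfigSpace K r ι) :
    crossRatio ε l a (forget I x) =
      crossRatio (ε.trans (Function.Embedding.subtype (· ∈ I))) l a x := by
  obtain ⟨p, rfl⟩ := Quotient.exists_rep x
  let v : ι → Fin r → K := fun i => (p.1 i).rep
  have hv : ∀ i, v i ≠ 0 := fun i => (p.1 i).rep_nonzero
  have hp : ∀ i, Projectivization.mk K (v i) (hv i) = p.1 i := fun i => (p.1 i).mk_rep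
  exact (crossRatio_mk ε l a ⟨fun i : I => p.1 i, p.2.comp (Function.Embedding.subtype (· ∈ I))⟩
    (fun i : I => v i) (fun i => hv i) fun i => hp i).trans
    (crossRatio_mk (ε.trans (Function.Embedding.subtype (· ∈ I))) l a p v hv hp).symm

theorem IsDominant.eq_zero_of_comp_eq_zero {X Y : Type*} {B : Subalgebra K (Y → K)} {f : X → Y}
    (hf : IsDominant B f) {g : Y → K} (hg : g ∈ B) (h : ∀ x, g (f x) = 0) (y : Y) : g y = 0 := by
  by_contra hy
  let _ := zariskiTopology B
  obtain ⟨_, hz, x, rfl⟩ := Dense.inter_open_nonempty hf {y | g y ≠ 0}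
    (TopologicalSpace.isOpen_generateFrom_of_mem ⟨g, hg, rfl⟩) ⟨y, hy⟩
  exact hz (h x)

/-- If the forgetful map is dominant, then every union of `m ≥ 1` of the label sets has at least
`m + r + 1` elements: otherwise the cross-ratios of these label sets are algebraically dependent
on the configuration space of their union. -/
theorem card_biUnion_of_isDominant [Infinite K] (hr : 2 ≤ r) {ι J : Type} [DecidableEq ι]
    [Fintype J] (I : J → Finset ι) (hI : ∀ j, (I j).card = r + 2)
    (hd : IsDominant (productRegular fun j => regularFunctions K r (I j))
      (forgetAll I : ConfigSpace K r ι → _)) (T : Finset J) (hT : T.Nonempty) :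
    T.card + r + 1 ≤ (T.biUnion I).card := by
  classical
  by_contra! hlt
  let l : Fin r := ⟨0, by omega⟩
  let S := T.biUnion I
  have ε : ∀ j, Labels r ≃ I j := fun j => Fintype.equivOfCardEq (by simp [hI])
  obtain ⟨j₀, hj₀⟩ := hT
  have hsub : ∀ j ∈ T, I j ⊆ S := fun j hj => Finset.subset_biUnion_of_mem I hj
  let η : ∀ j : T, Labels r ↪ S := fun j =>
    (ε j).toEmbedding.trans ⟨fun i => ⟨i, hsub j j.2 i.2⟩, fun i i' h =>
      Subtype.ext (congrArg (fun s : S => (s : ι)) h)⟩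
  have hS : r + 2 ≤ S.card := (hI j₀).symm.le.trans (Finset.card_le_card (hsub j₀ hj₀))
  obtain ⟨F, hF, hrel⟩ := exists_relation_crossRatio (K := K) l
    (τ := T × {a : Fin r // a ≠ l}) (fun x => η x.1) (fun x => x.2)
    (Function.Embedding.some.trans (η ⟨j₀, hj₀⟩)) (by
      rw [Fintype.card_prod, Fintype.card_subtype_compl]
      simp only [Fintype.card_coe, Fintype.card_fin, Fintype.card_unique]
      exact Nat.mul_lt_mul_of_pos_right (by change S.card < _ at hlt; omega) (by omega))
  let F' : MvPolynomial (J × {a : Fin r // a ≠ l}) K :=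
    MvPolynomial.rename (Prod.map Subtype.val id) F
  have hF' : F' ≠ 0 := fun h => hF (MvPolynomial.rename_injective _
    (Subtype.val_injective.prodMap Function.injective_id) (by rw [map_zero]; exact h))
  obtain ⟨z, hz⟩ := exists_eval_crossRatio_ne_zero (by omega) l ε F' hF'
  let ψ : J × {a : Fin r // a ≠ l} → productRegular fun j => regularFunctions K r (I j) :=
    fun x => ⟨fun z => crossRatio (ε x.1).toEmbedding l x.2 (z x.1),
      Algebra.subset_adjoin ⟨x.1, _, isRegular_crossRatio _ l x.2, rfl⟩⟩
  have hψ : ∀ z : ∀ j, ConfigSpace K r (I j), (MvPolynomial.aeval ψ F').1 z =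
      MvPolynomial.eval (fun x => crossRatio (ε x.1).toEmbedding l x.2 (z x.1)) F' := by
    intro z
    exact MvPolynomial.comp_aeval_apply (f := ψ)
      ((Pi.evalAlgHom K (fun _ => K) z).comp (Subalgebra.val _)) F'
  refine hz ((hψ z).symm.trans (hd.eq_zero_of_comp_eq_zero (MvPolynomial.aeval ψ F').2
    (fun x => ?_) z))
  rw [hψ, MvPolynomial.eval_rename, ← hrel (forget S x)]
  congr 2
  funext y
  exact (crossRatio_forget (I y.1) (ε y.1).toEmbedding l y.2 x).trans
    (crossRatio_forget S (η y.1) l y.2 x).symm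

end Surplus

end ProjConfig

theorem mainTheorem3 (K : Type*) [Field K] [IsAlgClosed K] [CharZero K] (r n : ℕ)
    (hr : 2 ≤ r) (hn : r + 1 ≤ n) (I : Fin (n - r - 1) → Finset (Fin n))
    (hI : ∀ j, (I j).card = r + 2) (hd : ProjConfig.configCount K r n hr hn I ≠ 0) :
    ProjConfig.SurplusCondition r n I := by
  refine ProjConfig.card_biUnion_of_isDominant (K := K) hr I hI ?_
  by_contra h
  exact hd (dif_neg h)
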